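/- Let $(\mathcal X_t,\mathcal B_t)$, $t=1,2,\dots$, be arbitrary measurable spaces, let $\Omega=\prod_{t\ge1}\mathcal X_t$ with the product $\sigma$-field $\mathcal F$, and for $\omega\in\Omega$ let $x_{1:\ell}=\omega_{1:\ell}$ be its first $\ell$ symbols. Let $P,Q$ be probability measures on $(\Omega,\mathcal F)$ with marginals $P_\ell,Q_\ell$ on $\mathcal X_1\times\dots\times\mathcal X_\ell$. Let $P(x_{1:\ell})$ and $Q(x_{1:\ell})$ be densities of $P_\ell$ and $Q_\ell$ relative to some common reference measure $M_\ell$ (for countable $\mathcal X_t$ and counting measure $M_\ell$ these are the probabilities that a sequence starts with $x_{1:\ell}$). A predictive distribution of $P$ is, for each $\ell$, a regular version (a Markov kernel) $P[\,\cdot\,|x_{1:\ell}]$ of the conditional distribution of the future $x_{\ell+1:\infty}$ given $x_{1:\ell}$; for $A\in\mathcal F$ write $P[A|x_{1:\ell}]$ for the probability that $x_{1:\ell}$ followed by such a future lies in $A$; similarly for $Q$. Put $$d(P,Q|x)=\sup_{A\in\mathcal F}\big|Q[A|x]-P[A|x]\big|,\qquad \Omega^\circ=\{\omega: Q(x_{1:\ell})/P(x_{1:\ell})\to0\},\qquad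 \vec\Omega=\{\omega: d(P,Q|x_{1:\ell})\to0\},$$ the limits being for $\ell\to\infty$. Then: (i) $P\ll Q$ if and only if $P[\Omega^\circ]=0$. If moreover every $\mathcal B_t$ is countably generated (for instance, if the $\mathcal X_t$ are countable with the discrete $\sigma$-field, or standard Borel), then for all predictive distributions of $P$ and of $Q$: (ii) if $P[\Omega^\circ]=0$, then $P$-almost every $\omega$ lies in $\vec\Omega$, i.e. $Q$ merges with $P$ in total variation; (iii) in general, $P$-almost every $\omega$ lies in $\Omega^\circ\cup\vec\Omega$. For arbitrary $\mathcal B_t$, (ii) and (iii) hold in the following form: for every predictive distribution of $Q$ there is a predictive distribution of $P$ such that (ii) holds, and, provided that $P$ has a predictive distribution at all, there is one such that (iii) holds. -/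

import Mathlib

open MeasureTheory ProbabilityTheory Filter Topology
open scoped ENNReal

namespace MergingOfOpinions

/-- The space of infinite sequences `(x_0, x_1, x_2, …)` with `x_t ∈ X t`; it carries the product
σ-algebra. -/
abbrev SeqSpace (X : ℕ → Type*) := ∀ t, X t

/-- The space of the first `ℓ` symbols. -/
abbrev Past (X : ℕ → Type*) (ℓ : ℕ) := ∀ t : {t : ℕ // t < ℓ}, X t

/-- The space of the symbols that come after the first `ℓ`. -/
abbrev Future (X : ℕ → Type*) (ℓ : ℕ) := ∀ t : {t : ℕ // ¬ t < ℓ}, X t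

variable {X : ℕ → Type*} [∀ t, MeasurableSpace (X t)]

/-- Splitting a sequence after its first `ℓ` symbols, as a measurable equivalence. -/
def split (X : ℕ → Type*) [∀ t, MeasurableSpace (X t)] (ℓ : ℕ) :
    SeqSpace X ≃ᵐ Past X ℓ × Future X ℓ :=
  MeasurableEquiv.piEquivPiSubtypeProd X (fun t => t < ℓ)

/-- The initial segment of length `ℓ` of a sequence. -/
def past (ℓ : ℕ) (ω : SeqSpace X) : Past X ℓ := fun t => ω t

/-- `p ℓ` is, for every `ℓ`, a density of the marginal of `P` on the first `ℓ` symbols relative to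
the reference measure `M ℓ`. For a countable discrete alphabet and counting measures `M ℓ`, the
number `p ℓ x` is the probability that a sequence starts with `x`. -/
def IsLocalDensity (P : Measure (SeqSpace X)) (M : ∀ ℓ, Measure (Past X ℓ))
    (p : ∀ ℓ, Past X ℓ → ℝ≥0∞) : Prop :=
  ∀ ℓ, Measurable (p ℓ) ∧ P.map (past ℓ) = (M ℓ).withDensity (p ℓ)

/-- `κ ℓ` is, for every `ℓ`, a (regular) version of the conditional distribution under `P` of the
future given the first `ℓ` symbols. -/
def IsPredictive (P : Measure (SeqSpace X)) (κ : ∀ ℓ, Kernel (Past X ℓ) (Future X ℓ)) : Prop :=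
  ∀ ℓ, IsMarkovKernel (κ ℓ) ∧ (P.map (split X ℓ)).IsCondKernel (κ ℓ)

/-- The conditional probability of an event `A` of sequences given the initial segment `x`:
the probability that `x` followed by a random future drawn from `κ x` lies in `A`. -/
noncomputable def condProb {ℓ : ℕ} (κ : Kernel (Past X ℓ) (Future X ℓ)) (x : Past X ℓ)
    (A : Set (SeqSpace X)) : ℝ :=
  (κ x).real {y | (split X ℓ).symm (x, y) ∈ A}

/-- The total variation distance between two predictive distributions given `x`: the supremum over
all events `A` of `|Q[A|x] - P[A|x]|`. -/
noncomputable def tvd {ℓ : ℕ} (κP κQ : Kernel (Past X ℓ) (Future X ℓ)) (x : Past X ℓ) : ℝ :=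
  ⨆ A : {A : Set (SeqSpace X) // MeasurableSet A}, |condProb κQ x A - condProb κP x A|

/-- The set of sequences along which the likelihood ratio `Q(x_{1:ℓ}) / P(x_{1:ℓ})` tends to 0. -/
def ratioVanishes (p q : ∀ ℓ, Past X ℓ → ℝ≥0∞) : Set (SeqSpace X) :=
  {ω | Tendsto (fun ℓ => q ℓ (past ℓ ω) / p ℓ (past ℓ ω)) atTop (𝓝 0)}

/-- The set of sequences along which the predictive distributions merge in total variation. -/
def merges (κP κQ : ∀ ℓ, Kernel (Past X ℓ) (Future X ℓ)) : Set (SeqSpace X) :=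
  {ω | Tendsto (fun ℓ => tvd (κP ℓ) (κQ ℓ) (past ℓ ω)) atTop (𝓝 0)}

end MergingOfOpinions

open MergingOfOpinions

namespace MergingOfOpinions

open scoped NNReal

variable {X : ℕ → Type*} [∀ t, MeasurableSpace (X t)]

/-! Split `P` into a part with density `r` relative to `Q` and a part carried by a `Q`-null set `N`.
Relative to `P + Q`, the measure `Q` has density `1 / (r + 1)` off `N` and `0` on `N`, and Lévy's
upward theorem makes `q / (p + q)` converge to it. Hence the ratio `q / p` tends `P`-a.e. to `1 / r`
off `N` and to `0` on `N` (`tendsto_ratio`). So `ratioVanishes` is `N` up to a `P`-null set, and (i)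
says that `P ≪ Q` iff `P N = 0`.

For merging, Bayes' rule gives a version of the predictive distribution of `P` that dominates that
of `Q` reweighted by `f = (q / p) * r` (`exists_predictive_ge`). This bounds the total variation
distance by the `Q`-predictive integral of the truncated difference `1 - f`. The factor `q / p`
varies with `ℓ`, but it eventually exceeds any constant `c < 1 / r ω`. For fixed `c` the function `1
- c * r` is bounded, so its predictive integrals converge to `1 - c * r ω`, which is small for `c`
near `1 / r ω` (`ae_mem_merges`).

When the σ-algebras are countably generated, predictive distributions are a.e. unique, so the
constructed version represents them all. -/

lemma countablyGenerated_pi {ι : Type*} [Countable ι] {Y : ι → Type*}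
    [∀ i, MeasurableSpace (Y i)] [h : ∀ i, MeasurableSpace.CountablyGenerated (Y i)] :
    MeasurableSpace.CountablyGenerated (∀ i, Y i) := by
  have h' : ∀ i, ∃ b : Set (Set (∀ i, Y i)), b.Countable ∧
      MeasurableSpace.comap (fun f : ∀ i, Y i => f i) inferInstance
        = MeasurableSpace.generateFrom b :=
    fun i => (MeasurableSpace.CountablyGenerated.comap
      (fun f : ∀ i, Y i => f i)).isCountablyGenerated
  choose b hb hgen using h'
  refine ⟨⋃ i, b i, Set.countable_iUnion hb, ?_⟩
  rw [← MeasurableSpace.iSup_generateFrom]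
  exact iSup_congr hgen

/-! ### Initial segments and Lévy's upward theorem -/

lemma measurable_past (ℓ : ℕ) : Measurable (past ℓ : SeqSpace X → Past X ℓ) :=
  measurable_pi_lambda _ fun _ => measurable_pi_apply _

lemma fst_map_split (P : Measure (SeqSpace X)) (ℓ : ℕ) :
    (P.map (split X ℓ)).fst = P.map (past ℓ) := by
  rw [Measure.fst, Measure.map_map measurable_fst (split X ℓ).measurable]
  rfl

/-- The filtration generated by the initial segments. -/
def pastFiltration (X : ℕ → Type*) [∀ t, MeasurableSpace (X t)] :
    Filtration ℕ (inferInstance : MeasurableSpace (SeqSpace X)) where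
  seq ℓ := MeasurableSpace.comap (past ℓ) inferInstance
  mono' := by
    intro k ℓ hkℓ
    have h : (past k : SeqSpace X → Past X k)
        = (fun (x : Past X ℓ) (t : {t : ℕ // t < k}) => x ⟨t, t.2.trans_le hkℓ⟩) ∘ past ℓ := rfl
    change MeasurableSpace.comap (past k) _ ≤ MeasurableSpace.comap (past ℓ) _
    rw [h, ← MeasurableSpace.comap_comp]
    exact MeasurableSpace.comap_mono
      (measurable_iff_comap_le.1 (measurable_pi_lambda _ fun t => measurable_pi_apply _))
  le' ℓ := (measurable_past ℓ).comap_le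

lemma iSup_pastFiltration :
    ⨆ ℓ, pastFiltration X ℓ = (inferInstance : MeasurableSpace (SeqSpace X)) := by
  refine le_antisymm (iSup_le fun ℓ => (pastFiltration X).le ℓ) (iSup_le fun t => ?_)
  refine le_trans ?_ (le_iSup (fun ℓ => (pastFiltration X) ℓ) (t + 1))
  have h : (fun ω : SeqSpace X => ω t)
      = (fun x : Past X (t + 1) => x ⟨t, t.lt_succ_self⟩) ∘ past (t + 1) := rfl
  rw [h, ← MeasurableSpace.comap_comp]
  exact MeasurableSpace.comap_mono (measurable_iff_comap_le.1 (measurable_pi_apply _))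

/-- Lévy's upward theorem for the initial segments, with the conditional expectations given as
densities of the marginals of `φ • μ`. -/
theorem tendsto_density_of_map_past (μ : Measure (SeqSpace X)) [IsFiniteMeasure μ]
    {φ : SeqSpace X → ℝ≥0∞} (hφ : Measurable φ) (hint : ∫⁻ ω, φ ω ∂μ ≠ ∞)
    {ψ : ∀ ℓ, Past X ℓ → ℝ≥0∞} (hψ : ∀ ℓ, Measurable (ψ ℓ))
    (h : ∀ ℓ, (μ.withDensity φ).map (past ℓ) = (μ.map (past ℓ)).withDensity (ψ ℓ)) :
    ∀ᵐ ω ∂μ, Tendsto (fun ℓ => ψ ℓ (past ℓ ω)) atTop (𝓝 (φ ω)) := by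
  -- The hypothesis on marginals, tested on events of the past, is the defining property of a
  -- conditional expectation.
  have hset : ∀ ℓ (s : Set (Past X ℓ)), MeasurableSet s →
      ∫⁻ ω in past ℓ ⁻¹' s, ψ ℓ (past ℓ ω) ∂μ = ∫⁻ ω in past ℓ ⁻¹' s, φ ω ∂μ := by
    intro ℓ s hs
    have h1 : (μ.withDensity φ).map (past ℓ) s = (μ.map (past ℓ)).withDensity (ψ ℓ) s := by
      rw [h ℓ]
    rw [Measure.map_apply (measurable_past ℓ) hs, withDensity_apply _ (measurable_past ℓ hs),
      withDensity_apply _ hs, setLIntegral_map hs (hψ ℓ) (measurable_past ℓ)] at h1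
    exact h1.symm
  have hψint : ∀ ℓ, ∫⁻ ω, ψ ℓ (past ℓ ω) ∂μ ≠ ∞ := by
    intro ℓ
    have := hset ℓ Set.univ MeasurableSet.univ
    simp only [Set.preimage_univ, Measure.restrict_univ] at this
    rwa [this]
  have hψm : ∀ ℓ, Measurable fun ω => ψ ℓ (past ℓ ω) := fun ℓ => (hψ ℓ).comp (measurable_past ℓ)
  have hψfin : ∀ ℓ, ∀ᵐ ω ∂μ, ψ ℓ (past ℓ ω) < ∞ := fun ℓ => ae_lt_top (hψm ℓ) (hψint ℓ)
  have hφfin : ∀ᵐ ω ∂μ, φ ω < ∞ := ae_lt_top hφ hint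
  have hφi : Integrable (fun ω => (φ ω).toReal) μ :=
    integrable_toReal_of_lintegral_ne_top hφ.aemeasurable hint
  have hce : ∀ ℓ, (fun ω => (ψ ℓ (past ℓ ω)).toReal)
      =ᵐ[μ] μ[fun ω => (φ ω).toReal | pastFiltration X ℓ] := by
    intro ℓ
    refine ae_eq_condExp_of_forall_setIntegral_eq ((pastFiltration X).le ℓ) hφi ?_ ?_ ?_
    · intro s _ _
      exact (integrable_toReal_of_lintegral_ne_top (hψm ℓ).aemeasurable (hψint ℓ)).integrableOn
    · rintro _ ⟨s, hs, rfl⟩ _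
      rw [integral_toReal (hψm ℓ).aemeasurable (ae_restrict_of_ae (hψfin ℓ)),
        integral_toReal hφ.aemeasurable (ae_restrict_of_ae hφfin), hset ℓ s hs]
    · refine StronglyMeasurable.aestronglyMeasurable ?_
      refine Measurable.stronglyMeasurable ?_
      exact (hψ ℓ).ennreal_toReal.comp (comap_measurable (past ℓ))
  have hlim := hφi.tendsto_ae_condExp (ℱ := pastFiltration X)
    (by rw [iSup_pastFiltration]; exact hφ.ennreal_toReal.stronglyMeasurable)
  filter_upwards [hlim, ae_all_iff.2 hce, ae_all_iff.2 hψfin, hφfin] with ω h1 h2 h3 h4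
  rw [← ENNReal.tendsto_toReal_iff (fun ℓ => (h3 ℓ).ne) h4.ne]
  exact h1.congr fun ℓ => (h2 ℓ).symm

/-! ### Integration against predictive distributions -/

lemma IsPredictive.compProd_eq {P : Measure (SeqSpace X)}
    {κ : ∀ ℓ, Kernel (Past X ℓ) (Future X ℓ)} (hκ : IsPredictive P κ) (ℓ : ℕ) :
    P.map (past ℓ) ⊗ₘ κ ℓ = P.map (split X ℓ) := by
  rw [← fst_map_split]
  exact (hκ ℓ).2.disintegrate

lemma setLIntegral_past_eq {P : Measure (SeqSpace X)} [IsFiniteMeasure P]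
    {κ : ∀ ℓ, Kernel (Past X ℓ) (Future X ℓ)} (hκ : IsPredictive P κ) {ℓ : ℕ}
    {f : SeqSpace X → ℝ≥0∞} (hf : Measurable f) {s : Set (Past X ℓ)} (hs : MeasurableSet s) :
    ∫⁻ ω in past ℓ ⁻¹' s, f ω ∂P
      = ∫⁻ x in s, ∫⁻ y, f ((split X ℓ).symm (x, y)) ∂(κ ℓ x) ∂(P.map (past ℓ)) := by
  have := (hκ ℓ).1
  have h := Measure.setLIntegral_compProd (μ := P.map (past ℓ)) (κ := κ ℓ)
    (hf.comp (split X ℓ).symm.measurable) hs MeasurableSet.univ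
  simp only [Measure.restrict_univ, Function.comp_apply] at h
  have h2 := setLIntegral_map (μ := P) (hs.prod MeasurableSet.univ)
    (hf.comp (split X ℓ).symm.measurable) (split X ℓ).measurable
  rw [← h, hκ.compProd_eq]
  refine Eq.trans ?_ h2.symm
  simp only [Function.comp_apply, MeasurableEquiv.symm_apply_apply]
  congr 2
  ext ω
  simp only [Set.mem_preimage, Set.mem_prod, Set.mem_univ, and_true]
  rfl

lemma lintegral_past_eq {P : Measure (SeqSpace X)} [IsFiniteMeasure P]
    {κ : ∀ ℓ, Kernel (Past X ℓ) (Future X ℓ)} (hκ : IsPredictive P κ) (ℓ : ℕ)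
    {f : SeqSpace X → ℝ≥0∞} (hf : Measurable f) :
    ∫⁻ ω, f ω ∂P
      = ∫⁻ x, ∫⁻ y, f ((split X ℓ).symm (x, y)) ∂(κ ℓ x) ∂(P.map (past ℓ)) := by
  simpa using setLIntegral_past_eq hκ (ℓ := ℓ) hf MeasurableSet.univ

lemma measurable_lintegral_split_symm {ℓ : ℕ} (κ : Kernel (Past X ℓ) (Future X ℓ))
    [IsSFiniteKernel κ] {f : SeqSpace X → ℝ≥0∞} (hf : Measurable f) :
    Measurable fun x => ∫⁻ y, f ((split X ℓ).symm (x, y)) ∂(κ x) :=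
  (hf.comp (split X ℓ).symm.measurable).lintegral_kernel_prod_right'

/-- The integral of a fixed function under the predictive distributions converges to the
function. -/
theorem tendsto_lintegral_predictive {Q : Measure (SeqSpace X)} [IsFiniteMeasure Q]
    {κ : ∀ ℓ, Kernel (Past X ℓ) (Future X ℓ)} (hκ : IsPredictive Q κ)
    {φ : SeqSpace X → ℝ≥0∞} (hφ : Measurable φ) (hint : ∫⁻ ω, φ ω ∂Q ≠ ∞) :
    ∀ᵐ ω ∂Q, Tendsto
      (fun ℓ => ∫⁻ y, φ ((split X ℓ).symm (past ℓ ω, y)) ∂(κ ℓ (past ℓ ω))) atTop (𝓝 (φ ω)) := by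
  have hm : ∀ ℓ, IsMarkovKernel (κ ℓ) := fun ℓ => (hκ ℓ).1
  refine tendsto_density_of_map_past Q hφ hint
    (ψ := fun ℓ x => ∫⁻ y, φ ((split X ℓ).symm (x, y)) ∂(κ ℓ x))
    (fun ℓ => measurable_lintegral_split_symm (κ ℓ) hφ) fun ℓ => ?_
  ext s hs
  rw [Measure.map_apply (measurable_past ℓ) hs, withDensity_apply _ (measurable_past ℓ hs),
    withDensity_apply _ hs, setLIntegral_past_eq hκ hφ hs]

lemma div_div_div_cancel {a b c : ℝ≥0∞} (hc : c ≠ 0) (hc' : c ≠ ∞) :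
    a / c / (b / c) = a / b := by
  rw [div_eq_mul_inv a c, div_eq_mul_inv b c]
  exact ENNReal.mul_div_mul_right a b (by simpa using hc') (by simpa using hc)

/-! ### Lebesgue decomposition -/

/-- `r` and `N` are a Lebesgue decomposition of `P` with respect to `Q`: the measure `P` has
density `r` relative to `Q` off the `Q`-null set `N`. -/
structure IsLebesgueSplitting {Ω : Type*} [MeasurableSpace Ω] (P Q : Measure Ω) (r : Ω → ℝ≥0)
    (N : Set Ω) : Prop where
  measurable : Measurable r
  measurableSet : MeasurableSet N
  null : Q N = 0
  eq_add : P = Q.withDensity (fun ω => (r ω : ℝ≥0∞)) + P.restrict N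

section Splitting

variable {Ω : Type*} [MeasurableSpace Ω] {P Q : Measure Ω}

lemma withDensity_toNNReal_rnDeriv [SigmaFinite P] :
    Q.withDensity (fun ω => ((P.rnDeriv Q ω).toNNReal : ℝ≥0∞)) = Q.withDensity (P.rnDeriv Q) := by
  refine withDensity_congr_ae ?_
  filter_upwards [P.rnDeriv_lt_top Q] with ω hω using ENNReal.coe_toNNReal hω.ne

lemma exists_isLebesgueSplitting (P Q : Measure Ω) [IsFiniteMeasure P] [IsFiniteMeasure Q] :
    ∃ r N, IsLebesgueSplitting P Q r N := by
  obtain ⟨N, hN, hSN, hQN⟩ := (P.mutuallySingular_singularPart Q)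
  refine ⟨fun ω => (P.rnDeriv Q ω).toNNReal, Nᶜ,
    (P.measurable_rnDeriv Q).ennreal_toNNReal, hN.compl, hQN, ?_⟩
  rw [withDensity_toNNReal_rnDeriv, ← Measure.singularPart_eq_restrict' (μ := P) (ν := Q)
    (by rwa [compl_compl]) (withDensity_absolutelyContinuous _ _ hQN),
    Measure.rnDeriv_add_singularPart]

/-- Taking `N` empty leaves no singular part to disintegrate, so (ii) need not presuppose a
predictive distribution of `P`. -/
lemma isLebesgueSplitting_of_absolutelyContinuous [IsFiniteMeasure P] [IsFiniteMeasure Q]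
    (h : P ≪ Q) : IsLebesgueSplitting P Q (fun ω => (P.rnDeriv Q ω).toNNReal) ∅ where
  measurable := (P.measurable_rnDeriv Q).ennreal_toNNReal
  measurableSet := MeasurableSet.empty
  null := measure_empty
  eq_add := by
    rw [withDensity_toNNReal_rnDeriv, Measure.restrict_empty, add_zero,
      Measure.withDensity_rnDeriv_eq P Q h]

namespace IsLebesgueSplitting

variable {r : Ω → ℝ≥0} {N : Set Ω}

lemma measurable_coe (h : IsLebesgueSplitting P Q r N) : Measurable fun ω => (r ω : ℝ≥0∞) :=
  h.measurable.coe_nnreal_ennreal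

lemma withDensity_le (h : IsLebesgueSplitting P Q r N) :
    Q.withDensity (fun ω => (r ω : ℝ≥0∞)) ≤ P := by
  conv_rhs => rw [h.eq_add]
  exact Measure.le_add_right le_rfl

lemma restrict_compl (h : IsLebesgueSplitting P Q r N) :
    P.restrict Nᶜ = Q.withDensity (fun ω => (r ω : ℝ≥0∞)) := by
  conv_lhs => rw [h.eq_add]
  rw [Measure.restrict_add, Measure.restrict_restrict h.measurableSet.compl, Set.compl_inter_self,
    Measure.restrict_empty, add_zero]
  refine Measure.restrict_eq_self_of_ae_mem ?_
  exact (withDensity_absolutelyContinuous Q _).ae_le (measure_eq_zero_iff_ae_notMem.1 h.null)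

/-- A property that holds `Q`-almost everywhere where the density is positive holds
`P`-almost everywhere off the singular set. -/
lemma ae_of_ae (h : IsLebesgueSplitting P Q r N) {p : Ω → Prop} (hp : ∀ᵐ ω ∂Q, p ω) :
    ∀ᵐ ω ∂P, ω ∉ N → r ω ≠ 0 ∧ p ω := by
  have h1 : ∀ᵐ ω ∂(P.restrict Nᶜ), r ω ≠ 0 ∧ p ω := by
    rw [h.restrict_compl, ae_withDensity_iff h.measurable_coe]
    filter_upwards [hp] with ω hω h0 using ⟨by simpa using h0, hω⟩
  exact (ae_restrict_iff' h.measurableSet.compl).1 h1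

lemma absolutelyContinuous_iff (h : IsLebesgueSplitting P Q r N) : P ≪ Q ↔ P N = 0 := by
  refine ⟨fun hPQ => hPQ h.null, fun h0 => ?_⟩
  rw [h.eq_add, Measure.restrict_eq_zero.2 h0, add_zero]
  exact withDensity_absolutelyContinuous _ _

lemma measurable_indicator_inv (h : IsLebesgueSplitting P Q r N) :
    Measurable (Nᶜ.indicator fun ω => (r ω + 1 : ℝ≥0∞)⁻¹) :=
  ((h.measurable_coe.add measurable_const).inv).indicator h.measurableSet.compl

/-- The density of `Q` relative to `P + Q`. -/
lemma withDensity_add_eq (h : IsLebesgueSplitting P Q r N) :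
    (P + Q).withDensity (Nᶜ.indicator fun ω => (r ω + 1 : ℝ≥0∞)⁻¹) = Q := by
  set u : Ω → ℝ≥0∞ := Nᶜ.indicator fun ω => (r ω + 1 : ℝ≥0∞)⁻¹ with hu
  have hum : Measurable u := h.measurable_indicator_inv
  -- The indicator kills the part of `P` on `N`.
  have h1 : P.withDensity u = Q.withDensity ((fun ω => (r ω : ℝ≥0∞)) * u) := by
    conv_lhs => rw [h.eq_add]
    rw [withDensity_add_measure, withDensity_mul _ h.measurable_coe hum]
    have : (P.restrict N).withDensity u = 0 := by
      refine withDensity_eq_zero_iff hum.aemeasurable |>.2 ?_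
      filter_upwards [ae_restrict_mem h.measurableSet] with ω hω
      simp [hu, hω]
    rw [this, add_zero]
  rw [withDensity_add_measure, h1, ← withDensity_add_left (h.measurable_coe.mul hum)]
  conv_rhs => rw [← withDensity_one (μ := Q)]
  refine withDensity_congr_ae ?_
  filter_upwards [measure_eq_zero_iff_ae_notMem.1 h.null] with ω hω
  have hω' : ω ∈ Nᶜ := hω
  simp only [Pi.add_apply, Pi.mul_apply, hu, Set.indicator_of_mem hω', Pi.one_apply]
  rw [← add_one_mul]
  exact ENNReal.mul_inv_cancel (by simp) (by simp)

end IsLebesgueSplitting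

end Splitting

/-! ### Likelihood ratios and absolute continuity -/

section Density

variable {P Q : Measure (SeqSpace X)} {M : ∀ ℓ, Measure (Past X ℓ)} {p q : ∀ ℓ, Past X ℓ → ℝ≥0∞}

lemma IsLocalDensity.ae_lt_top [IsFiniteMeasure P] (hp : IsLocalDensity P M p) (ℓ : ℕ) :
    ∀ᵐ x ∂(M ℓ), p ℓ x < ∞ := by
  refine MeasureTheory.ae_lt_top (hp ℓ).1 ?_
  rw [← setLIntegral_univ, ← withDensity_apply _ MeasurableSet.univ, ← (hp ℓ).2]
  have := Measure.isFiniteMeasure_map P (past ℓ)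
  exact measure_ne_top _ _

lemma IsLocalDensity.map_absolutelyContinuous (hp : IsLocalDensity P M p) (ℓ : ℕ) :
    P.map (past ℓ) ≪ M ℓ := by
  rw [(hp ℓ).2]; exact withDensity_absolutelyContinuous _ _

lemma IsLocalDensity.ae_ne_zero (hp : IsLocalDensity P M p) (ℓ : ℕ) :
    ∀ᵐ x ∂(P.map (past ℓ)), p ℓ x ≠ 0 := by
  rw [(hp ℓ).2, ae_withDensity_iff (hp ℓ).1]
  exact Eventually.of_forall fun x hx => hx

/-- Almost surely, the local densities are positive and finite along the sequence. -/
lemma ae_densities [IsFiniteMeasure P] [IsFiniteMeasure Q] (hp : IsLocalDensity P M p)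
    (hq : IsLocalDensity Q M q) :
    ∀ᵐ ω ∂P, ∀ ℓ, p ℓ (past ℓ ω) ≠ 0 ∧ p ℓ (past ℓ ω) ≠ ∞ ∧ q ℓ (past ℓ ω) ≠ ∞ := by
  refine ae_all_iff.2 fun ℓ => ae_of_ae_map (measurable_past ℓ).aemeasurable
    (p := fun x => p ℓ x ≠ 0 ∧ p ℓ x ≠ ∞ ∧ q ℓ x ≠ ∞) ?_
  filter_upwards [hp.ae_ne_zero ℓ, (hp.map_absolutelyContinuous ℓ).ae_le (hp.ae_lt_top ℓ),
    (hp.map_absolutelyContinuous ℓ).ae_le (hq.ae_lt_top ℓ)] with x h1 h2 h3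
  exact ⟨h1, h2.ne, h3.ne⟩

/-- The likelihood ratio converges to the density of `Q` relative to `P`. -/
theorem tendsto_ratio [IsFiniteMeasure P] [IsFiniteMeasure Q] (hp : IsLocalDensity P M p)
    (hq : IsLocalDensity Q M q) {r : SeqSpace X → ℝ≥0} {N : Set (SeqSpace X)}
    (h : IsLebesgueSplitting P Q r N) :
    ∀ᵐ ω ∂P, Tendsto (fun ℓ => q ℓ (past ℓ ω) / p ℓ (past ℓ ω)) atTop
      (𝓝 (Nᶜ.indicator (fun ω => (r ω : ℝ≥0∞)⁻¹) ω)) := by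
  -- Under `P` alone the ratio `q / p` need not be a martingale, since `Q` may charge pasts that `P`
  -- does not. Under `P + Q` the fraction `q / (p + q)` is a closed martingale.
  have hlim := tendsto_density_of_map_past (P + Q) h.measurable_indicator_inv
    (by
      rw [← setLIntegral_univ, ← withDensity_apply _ MeasurableSet.univ, h.withDensity_add_eq]
      exact measure_ne_top _ _)
    (ψ := fun ℓ => q ℓ / (p ℓ + q ℓ))
    (fun ℓ => (hq ℓ).1.div ((hp ℓ).1.add (hq ℓ).1))
    (fun ℓ => by
      rw [h.withDensity_add_eq, Measure.map_add _ _ (measurable_past ℓ), (hp ℓ).2, (hq ℓ).2,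
        ← withDensity_add_left (hp ℓ).1,
        ← withDensity_mul _ ((hp ℓ).1.add (hq ℓ).1) ((hq ℓ).1.div ((hp ℓ).1.add (hq ℓ).1))]
      refine withDensity_congr_ae ?_
      filter_upwards [hp.ae_lt_top ℓ, hq.ae_lt_top ℓ] with x h1 h2
      simp only [Pi.mul_apply, Pi.add_apply, Pi.div_apply]
      refine (ENNReal.mul_div_cancel' (fun h0 => ?_) (fun h0 => ?_)).symm
      · exact (add_eq_zero.1 h0).2
      · exact absurd h0 (ENNReal.add_lt_top.2 ⟨h1, h2⟩).ne)
  have hlim' := (Measure.le_add_right (le_refl P) : P ≤ P + Q).absolutelyContinuous.ae_le hlim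
  simp only [Pi.add_apply, Pi.div_apply] at hlim'
  filter_upwards [hlim', ae_densities hp hq] with ω h1 h2
  -- With `t = q / (p + q)`, the ratio `q / p` is `t / (1 - t)`, and its limit has the same form.
  have hrat : ∀ ℓ, q ℓ (past ℓ ω) / p ℓ (past ℓ ω)
      = q ℓ (past ℓ ω) / (p ℓ (past ℓ ω) + q ℓ (past ℓ ω))
        / (1 - q ℓ (past ℓ ω) / (p ℓ (past ℓ ω) + q ℓ (past ℓ ω))) := by
    intro ℓ
    obtain ⟨ha, ha', hb⟩ := h2 ℓ
    generalize p ℓ (past ℓ ω) = a at *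
    generalize q ℓ (past ℓ ω) = b at *
    have hs0 : a + b ≠ 0 := fun h0 => ha (add_eq_zero.1 h0).1
    have hs : a + b ≠ ∞ := ENNReal.add_ne_top.2 ⟨ha', hb⟩
    have h3 : 1 - b / (a + b) = a / (a + b) := by
      refine ENNReal.sub_eq_of_eq_add (ENNReal.div_ne_top hb hs0) ?_
      rw [← ENNReal.add_div, ENNReal.div_self hs0 hs]
    rw [h3, div_div_div_cancel hs0 hs]
  have hval : Nᶜ.indicator (fun ω => (r ω : ℝ≥0∞)⁻¹) ω
      = Nᶜ.indicator (fun ω => (r ω + 1 : ℝ≥0∞)⁻¹) ω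
        / (1 - Nᶜ.indicator (fun ω => (r ω + 1 : ℝ≥0∞)⁻¹) ω) := by
    by_cases hω : ω ∈ N
    · simp [hω]
    · have hω' : ω ∈ Nᶜ := hω
      simp only [Set.indicator_of_mem hω']
      have hr : (r ω : ℝ≥0∞) + 1 ≠ ∞ := by simp
      have h3 : 1 - ((r ω : ℝ≥0∞) + 1)⁻¹ = r ω / (r ω + 1) := by
        refine ENNReal.sub_eq_of_eq_add (by simp) ?_
        rw [← one_div, ← ENNReal.add_div, ENNReal.div_self (by simp) hr]
      rw [h3, ← one_div ((r ω : ℝ≥0∞) + 1), div_div_div_cancel (by simp) hr, one_div]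
  simp_rw [hrat]
  rw [hval]
  have hu1 : Nᶜ.indicator (fun ω => (r ω + 1 : ℝ≥0∞)⁻¹) ω ≤ 1 := by
    refine Set.indicator_le' (fun x _ => ?_) (fun _ _ => zero_le_one) ω
    simp
  -- Division is continuous here because `t` and `1 - t` cannot both vanish; `t = 1` yields the
  -- limit `∞`.
  refine ENNReal.Tendsto.div h1 ?_ (ENNReal.Tendsto.sub tendsto_const_nhds h1 (by simp)) ?_
  · by_cases h0 : Nᶜ.indicator (fun ω => (r ω + 1 : ℝ≥0∞)⁻¹) ω = 0
    · right; simp [h0]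
    · exact Or.inl h0
  · exact Or.inl (ENNReal.sub_ne_top ENNReal.one_ne_top)

/-- The likelihood ratio vanishes exactly on the part of `P` that is singular to `Q`. -/
theorem ae_mem_ratioVanishes_iff [IsFiniteMeasure P] [IsFiniteMeasure Q]
    (hp : IsLocalDensity P M p) (hq : IsLocalDensity Q M q) {r : SeqSpace X → ℝ≥0}
    {N : Set (SeqSpace X)} (h : IsLebesgueSplitting P Q r N) :
    ∀ᵐ ω ∂P, ω ∈ ratioVanishes p q ↔ ω ∈ N := by
  filter_upwards [tendsto_ratio hp hq h] with ω hω
  refine ⟨fun h0 => ?_, fun hN => ?_⟩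
  · by_contra hN
    have h1 := tendsto_nhds_unique hω h0
    rw [Set.indicator_of_mem (show ω ∈ Nᶜ from hN)] at h1
    simp at h1
  · rw [Set.indicator_of_notMem (by simpa using hN)] at hω
    exact hω

theorem absolutelyContinuous_iff_ratioVanishes [IsFiniteMeasure P] [IsFiniteMeasure Q]
    (hp : IsLocalDensity P M p) (hq : IsLocalDensity Q M q) :
    P ≪ Q ↔ P (ratioVanishes p q) = 0 := by
  obtain ⟨r, N, h⟩ := exists_isLebesgueSplitting P Q
  rw [h.absolutelyContinuous_iff]
  refine Eq.congr_left (measure_congr ?_)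
  filter_upwards [ae_mem_ratioVanishes_iff hp hq h] with ω hω
  exact propext hω.symm

end Density

/-! ### Bayes' rule for predictive distributions -/

section Construction

variable {P Q : Measure (SeqSpace X)} {M : ∀ ℓ, Measure (Past X ℓ)} {p q : ∀ ℓ, Past X ℓ → ℝ≥0∞}

lemma measurable_comp_split_symm {β : Type*} [MeasurableSpace β] {ℓ : ℕ} {f : SeqSpace X → β}
    (hf : Measurable f) :
    Measurable (Function.uncurry fun (x : Past X ℓ) (y : Future X ℓ) =>
      f ((split X ℓ).symm (x, y))) :=
  hf.comp (split X ℓ).symm.measurable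

lemma map_split_withDensity (P : Measure (SeqSpace X)) (ℓ : ℕ) {f : SeqSpace X → ℝ≥0∞}
    (hf : Measurable f) :
    (P.withDensity f).map (split X ℓ)
      = (P.map (split X ℓ)).withDensity fun z => f ((split X ℓ).symm z) := by
  ext s hs
  rw [Measure.map_apply (split X ℓ).measurable hs, withDensity_apply _ hs,
    withDensity_apply _ ((split X ℓ).measurable hs)]
  refine Eq.trans ?_ (setLIntegral_map (μ := P) hs
    (hf.comp (split X ℓ).symm.measurable) (split X ℓ).measurable).symm
  simp

/-- Restricting a predictive distribution to an event disintegrates the restriction of the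
measure. -/
lemma compProd_withDensity_indicator [IsFiniteMeasure P]
    {κ : ∀ ℓ, Kernel (Past X ℓ) (Future X ℓ)} (hκ : IsPredictive P κ) {N : Set (SeqSpace X)}
    (hN : MeasurableSet N) (ℓ : ℕ) [IsMarkovKernel (κ ℓ)] :
    P.map (past ℓ) ⊗ₘ (κ ℓ).withDensity
        (fun x y => ((N.indicator 1 ((split X ℓ).symm (x, y)) : ℝ≥0) : ℝ≥0∞))
      = (P.restrict N).map (split X ℓ) := by
  have hm : Measurable (fun ω => ((N.indicator 1 ω : ℝ≥0) : ℝ≥0∞)) :=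
    (measurable_one.indicator hN).coe_nnreal_ennreal
  have h1 : P.restrict N = P.withDensity fun ω => ((N.indicator 1 ω : ℝ≥0) : ℝ≥0∞) := by
    rw [← withDensity_indicator_one hN]
    congr 1
    ext ω
    by_cases hω : ω ∈ N <;> simp [hω]
  rw [Measure.compProd_withDensity (measurable_comp_split_symm hm), hκ.compProd_eq, h1,
    map_split_withDensity _ _ hm]

/-- Reweighting a predictive distribution of `Q` by the likelihood ratio disintegrates the
absolutely continuous part of `P`. -/
lemma compProd_withDensity_ratio [IsFiniteMeasure P] [IsFiniteMeasure Q]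
    (hp : IsLocalDensity P M p) (hq : IsLocalDensity Q M q) {r : SeqSpace X → ℝ≥0}
    {N : Set (SeqSpace X)} (h : IsLebesgueSplitting P Q r N)
    {κ : ∀ ℓ, Kernel (Past X ℓ) (Future X ℓ)} (hκ : IsPredictive Q κ) (ℓ : ℕ)
    [IsMarkovKernel (κ ℓ)] :
    P.map (past ℓ) ⊗ₘ (κ ℓ).withDensity
        (fun x y => (((q ℓ x / p ℓ x).toNNReal * r ((split X ℓ).symm (x, y)) : ℝ≥0) : ℝ≥0∞))
      = (Q.withDensity fun ω => (r ω : ℝ≥0∞)).map (split X ℓ) := by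
  have hR : Measurable fun x => (q ℓ x / p ℓ x).toNNReal :=
    ((hq ℓ).1.div (hp ℓ).1).ennreal_toNNReal
  have hk : Measurable (Function.uncurry fun (x : Past X ℓ) (y : Future X ℓ) =>
      (((q ℓ x / p ℓ x).toNNReal * r ((split X ℓ).symm (x, y)) : ℝ≥0) : ℝ≥0∞)) :=
    ((hR.comp measurable_fst).mul (measurable_comp_split_symm h.measurable)).coe_nnreal_ennreal
  ext s hs
  set g : SeqSpace X → ℝ≥0∞ := (split X ℓ ⁻¹' s).indicator fun ω => (r ω : ℝ≥0∞) with hg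
  have hgm : Measurable g := h.measurable_coe.indicator ((split X ℓ).measurable hs)
  set F : Past X ℓ → ℝ≥0∞ := fun x => ∫⁻ y, g ((split X ℓ).symm (x, y)) ∂(κ ℓ x) with hF
  have hFm : Measurable F := measurable_lintegral_split_symm (κ ℓ) hgm
  have hleft : ∀ x, (κ ℓ).withDensity
      (fun x y => (((q ℓ x / p ℓ x).toNNReal * r ((split X ℓ).symm (x, y)) : ℝ≥0) : ℝ≥0∞)) x
      (Prod.mk x ⁻¹' s) = ((q ℓ x / p ℓ x).toNNReal : ℝ≥0∞) * F x := by
    intro x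
    rw [Kernel.withDensity_apply' _ hk, hF]
    simp only [ENNReal.coe_mul]
    have hrx : Measurable fun y => (r ((split X ℓ).symm (x, y)) : ℝ≥0∞) :=
      h.measurable_coe.comp ((split X ℓ).symm.measurable.comp measurable_prodMk_left)
    rw [lintegral_const_mul _ hrx, ← lintegral_indicator (measurable_prodMk_left hs)]
    congr 2
    ext y
    have hiff : (split X ℓ).symm (x, y) ∈ split X ℓ ⁻¹' s ↔ (x, y) ∈ s := by
      rw [Set.mem_preimage, MeasurableEquiv.apply_symm_apply]
    by_cases hy : (x, y) ∈ s
    · rw [hg, Set.indicator_of_mem (hiff.2 hy),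
        Set.indicator_of_mem (show y ∈ Prod.mk x ⁻¹' s from hy)]
    · rw [hg, Set.indicator_of_notMem (mt hiff.1 hy),
        Set.indicator_of_notMem (show y ∉ Prod.mk x ⁻¹' s from hy)]
  have hright : (Q.withDensity fun ω => (r ω : ℝ≥0∞)).map (split X ℓ) s
      = ∫⁻ x, F x ∂(Q.map (past ℓ)) := by
    rw [Measure.map_apply (split X ℓ).measurable hs,
      withDensity_apply _ ((split X ℓ).measurable hs),
      ← lintegral_indicator ((split X ℓ).measurable hs)]
    exact lintegral_past_eq hκ ℓ hgm
  have hZ : MeasurableSet {x | p ℓ x = 0} := (hp ℓ).1 (measurableSet_singleton 0)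
  -- Where `p` vanishes the weight is a default value. This is harmless: `P` gives such pasts mass
  -- zero, hence so does the smaller measure with `Q`-density `r`.
  have hnull : ∀ᵐ x ∂(Q.map (past ℓ)), p ℓ x = 0 → F x = 0 := by
    refine (ae_restrict_iff' hZ).1 ((lintegral_eq_zero_iff hFm).1 (le_antisymm ?_ bot_le))
    calc ∫⁻ x in {x | p ℓ x = 0}, F x ∂(Q.map (past ℓ))
        = ∫⁻ ω in past ℓ ⁻¹' {x | p ℓ x = 0}, g ω ∂Q := (setLIntegral_past_eq hκ hgm hZ).symm
      _ ≤ ∫⁻ ω in past ℓ ⁻¹' {x | p ℓ x = 0}, (r ω : ℝ≥0∞) ∂Q :=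
          lintegral_mono (Set.indicator_le_self _ _)
      _ = Q.withDensity (fun ω => (r ω : ℝ≥0∞)) (past ℓ ⁻¹' {x | p ℓ x = 0}) :=
          (withDensity_apply _ (measurable_past ℓ hZ)).symm
      _ ≤ P (past ℓ ⁻¹' {x | p ℓ x = 0}) := h.withDensity_le _
      _ = 0 := by
          rw [← Measure.map_apply (measurable_past ℓ) hZ]
          simpa [ae_iff] using hp.ae_ne_zero ℓ
  rw [Measure.compProd_apply hs, hright]
  simp_rw [hleft]
  rw [(hq ℓ).2, ae_withDensity_iff (hq ℓ).1] at hnull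
  have hRF : Measurable fun x => ((q ℓ x / p ℓ x).toNNReal : ℝ≥0∞) * F x :=
    hR.coe_nnreal_ennreal.mul hFm
  rw [(hp ℓ).2, (hq ℓ).2, lintegral_withDensity_eq_lintegral_mul _ (hp ℓ).1 hRF,
    lintegral_withDensity_eq_lintegral_mul _ (hq ℓ).1 hFm]
  refine lintegral_congr_ae ?_
  filter_upwards [hnull, hp.ae_lt_top ℓ, hq.ae_lt_top ℓ] with x h1 h2 h3
  simp only [Pi.mul_apply]
  by_cases hp0 : p ℓ x = 0
  · by_cases hq0 : q ℓ x = 0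
    · simp [hp0, hq0]
    · simp [hp0, h1 hq0 hp0]
  · rw [ENNReal.coe_toNNReal (ENNReal.div_ne_top h3.ne hp0), ← mul_assoc,
      ENNReal.mul_div_cancel hp0 h2.ne]

/-- A predictive distribution of `P` obtained by reweighting a predictive distribution of `Q` by
the likelihood ratio and adding a disintegration of the singular part of `P`. -/
theorem exists_predictive_ge [IsFiniteMeasure P] [IsFiniteMeasure Q]
    (hp : IsLocalDensity P M p) (hq : IsLocalDensity Q M q) {r : SeqSpace X → ℝ≥0}
    {N : Set (SeqSpace X)} (h : IsLebesgueSplitting P Q r N)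
    {κ : ∀ ℓ, Kernel (Past X ℓ) (Future X ℓ)} (hκ : IsPredictive Q κ)
    (σ : ∀ ℓ, Kernel (Past X ℓ) (Future X ℓ)) [∀ ℓ, IsSFiniteKernel (σ ℓ)]
    (hσ : ∀ ℓ, P.map (past ℓ) ⊗ₘ σ ℓ = (P.restrict N).map (split X ℓ)) :
    ∃ κP : ∀ ℓ, Kernel (Past X ℓ) (Future X ℓ), IsPredictive P κP ∧
      ∀ ℓ, ∀ᵐ x ∂(P.map (past ℓ)),
        (κ ℓ x).withDensity (fun y => q ℓ x / p ℓ x * r ((split X ℓ).symm (x, y))) ≤ κP ℓ x := by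
  have hm : ∀ ℓ, IsMarkovKernel (κ ℓ) := fun ℓ => (hκ ℓ).1
  let ρ : ∀ ℓ, Kernel (Past X ℓ) (Future X ℓ) := fun ℓ => (κ ℓ).withDensity
    (fun x y => (((q ℓ x / p ℓ x).toNNReal * r ((split X ℓ).symm (x, y)) : ℝ≥0) : ℝ≥0∞))
  let ν : ∀ ℓ, Kernel (Past X ℓ) (Future X ℓ) := fun ℓ => ρ ℓ + σ ℓ
  have hρ : ∀ ℓ, IsSFiniteKernel (ρ ℓ) := fun ℓ => inferInstance
  have hνs : ∀ ℓ, IsSFiniteKernel (ν ℓ) := fun ℓ => inferInstance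
  have hν : ∀ ℓ, P.map (past ℓ) ⊗ₘ ν ℓ = P.map (split X ℓ) := by
    intro ℓ
    rw [Measure.compProd_add_right, compProd_withDensity_ratio hp hq h hκ ℓ, hσ ℓ,
      ← Measure.map_add _ _ (split X ℓ).measurable, ← h.eq_add]
  have hG : ∀ ℓ, MeasurableSet {x | ν ℓ x Set.univ = 1} := fun ℓ =>
    (ν ℓ).measurable_coe MeasurableSet.univ (measurableSet_singleton 1)
  -- Both sides integrate to the marginal of `P` over every set of pasts.
  have hmass : ∀ ℓ, ∀ᵐ x ∂(P.map (past ℓ)), ν ℓ x Set.univ = 1 := by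
    intro ℓ
    refine ae_eq_of_forall_setLIntegral_eq_of_sigmaFinite
      ((ν ℓ).measurable_coe MeasurableSet.univ) measurable_const fun s hs _ => ?_
    rw [← Measure.compProd_apply_prod hs MeasurableSet.univ, hν,
      setLIntegral_const, one_mul, ← fst_map_split, Measure.fst_apply hs, Set.prod_univ]
  classical
  -- The mass is one only almost everywhere; elsewhere the Markov kernel of `Q` serves as a filler.
  let τ : ∀ ℓ, Kernel (Past X ℓ) (Future X ℓ) := fun ℓ => Kernel.piecewise (hG ℓ) (ν ℓ) (κ ℓ)
  have hτ : ∀ ℓ, ∀ᵐ x ∂(P.map (past ℓ)), τ ℓ x = ν ℓ x := by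
    intro ℓ
    filter_upwards [hmass ℓ] with x hx
    exact if_pos hx
  have hτm : ∀ ℓ, IsMarkovKernel (τ ℓ) := by
    refine fun ℓ => ⟨fun x => ⟨?_⟩⟩
    rw [Kernel.piecewise_apply']
    split_ifs with hx
    · exact hx
    · exact measure_univ
  refine ⟨τ, fun ℓ => ⟨hτm ℓ, ⟨?_⟩⟩, fun ℓ => ?_⟩
  · rw [fst_map_split, ← hν ℓ]
    exact Measure.compProd_congr (hτ ℓ)
  · filter_upwards [hτ ℓ, hp.ae_ne_zero ℓ,
      (hp.map_absolutelyContinuous ℓ).ae_le (hq.ae_lt_top ℓ)] with x hx hp0 hq1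
    have hk : Measurable (Function.uncurry fun (x : Past X ℓ) (y : Future X ℓ) =>
        (((q ℓ x / p ℓ x).toNNReal * r ((split X ℓ).symm (x, y)) : ℝ≥0) : ℝ≥0∞)) :=
      (((((hq ℓ).1.div (hp ℓ).1).ennreal_toNNReal).comp measurable_fst).mul
        (measurable_comp_split_symm h.measurable)).coe_nnreal_ennreal
    have h1 : (κ ℓ x).withDensity (fun y => q ℓ x / p ℓ x * r ((split X ℓ).symm (x, y)))
        = ρ ℓ x := by
      rw [Kernel.withDensity_apply _ hk]
      simp only [ENNReal.coe_mul, ENNReal.coe_toNNReal (ENNReal.div_ne_top hq1.ne hp0)]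
    rw [hx, h1]
    exact Measure.le_add_right le_rfl

end Construction

/-! ### Merging in total variation -/

section Merging

/-- Since `1 ≤ (1 - f) + f`, the mass of an event under `ν` exceeds that under `μ` by at most the
integral of `1 - f`. Equal total masses give the reverse bound through the complement. -/
lemma abs_real_sub_real_le {α : Type*} [MeasurableSpace α] {μ ν : Measure α}
    [IsProbabilityMeasure μ] [IsProbabilityMeasure ν] {f : α → ℝ≥0∞} (hf : Measurable f)
    (h : ν.withDensity f ≤ μ) {A : Set α} (hA : MeasurableSet A) :
    |ν.real A - μ.real A| ≤ (∫⁻ y, (1 - f y) ∂ν).toReal := by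
  have hfin : ∫⁻ y, (1 - f y) ∂ν ≠ ∞ := by
    refine ne_top_of_le_ne_top ENNReal.one_ne_top ?_
    calc ∫⁻ y, (1 - f y) ∂ν ≤ ∫⁻ _, 1 ∂ν := lintegral_mono fun y => tsub_le_self
      _ = 1 := by simp
  have key : ∀ B, MeasurableSet B → ν.real B ≤ (∫⁻ y, (1 - f y) ∂ν).toReal + μ.real B := by
    intro B hB
    have h1 : ν B ≤ ∫⁻ y, (1 - f y) ∂ν + μ B := by
      calc ν B = ∫⁻ _ in B, 1 ∂ν := by simp
        _ ≤ ∫⁻ y in B, ((1 - f y) + f y) ∂ν := lintegral_mono fun y => le_tsub_add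
        _ = ∫⁻ y in B, (1 - f y) ∂ν + ∫⁻ y in B, f y ∂ν := lintegral_add_right _ hf
        _ ≤ ∫⁻ y, (1 - f y) ∂ν + μ B := by
            refine add_le_add (setLIntegral_le_lintegral _ _) ?_
            rw [← withDensity_apply _ hB]
            exact h B
    rw [Measure.real, Measure.real, ← ENNReal.toReal_add hfin (measure_ne_top _ _)]
    exact ENNReal.toReal_mono (ENNReal.add_ne_top.2 ⟨hfin, measure_ne_top _ _⟩) h1
  have h1 := key A hA
  have h2 := key Aᶜ hA.compl
  rw [probReal_compl_eq_one_sub hA, probReal_compl_eq_one_sub hA] at h2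
  rw [abs_le]
  constructor <;> linarith

lemma tvd_nonneg {ℓ : ℕ} (κP κQ : Kernel (Past X ℓ) (Future X ℓ)) (x : Past X ℓ) :
    0 ≤ tvd κP κQ x :=
  Real.iSup_nonneg fun _ => abs_nonneg _

lemma tvd_le {ℓ : ℕ} (κP κQ : Kernel (Past X ℓ) (Future X ℓ)) [IsMarkovKernel κP]
    [IsMarkovKernel κQ] (x : Past X ℓ) {f : Future X ℓ → ℝ≥0∞} (hf : Measurable f)
    (h : (κQ x).withDensity f ≤ κP x) :
    tvd κP κQ x ≤ (∫⁻ y, (1 - f y) ∂(κQ x)).toReal := by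
  have : Nonempty {A : Set (SeqSpace X) // MeasurableSet A} := ⟨⟨∅, MeasurableSet.empty⟩⟩
  exact ciSup_le fun A => abs_real_sub_real_le hf h
    ((split X ℓ).symm.measurable.comp measurable_prodMk_left A.2)

variable {P Q : Measure (SeqSpace X)} {M : ∀ ℓ, Measure (Past X ℓ)} {p q : ∀ ℓ, Past X ℓ → ℝ≥0∞}

/-- A rational `c` is sought so that countably many exceptional null sets suffice in
`ae_mem_merges`. -/
lemma exists_rat_one_sub_mul_lt {a ε : ℝ≥0∞} (ha : a ≠ 0) (ha' : a ≠ ∞) (hε : 0 < ε) :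
    ∃ c : ℚ, (Real.toNNReal c : ℝ≥0∞) < a⁻¹ ∧ 1 - Real.toNNReal c * a < ε := by
  by_cases h1 : 1 < ε
  · exact ⟨0, by simpa using ha', by simpa using h1⟩
  · have hε1 : ε ≤ 1 := not_lt.1 h1
    have hεt : ε ≠ ∞ := ne_top_of_le_ne_top ENNReal.one_ne_top hε1
    have hlt : (1 - ε) * a⁻¹ < a⁻¹ := by
      have h2 : 1 - ε < 1 := ENNReal.sub_lt_self ENNReal.one_ne_top one_ne_zero hε.ne'
      simpa using ENNReal.mul_lt_mul_left (by simpa using ha') (by simpa using ha) h2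
    obtain ⟨c, -, hc1, hc2⟩ := ENNReal.lt_iff_exists_rat_btwn.1 hlt
    refine ⟨c, hc2, ?_⟩
    have h3 : 1 - ε < Real.toNNReal c * a := by
      rw [← div_eq_mul_inv] at hc1
      exact (ENNReal.div_lt_iff (Or.inl ha) (Or.inl ha')).1 hc1
    have h4 : (Real.toNNReal c : ℝ≥0∞) * a ≤ 1 :=
      (mul_le_mul_left hc2.le a).trans (ENNReal.inv_mul_cancel ha ha').le
    refine (ENNReal.sub_lt_iff_lt_right (by finiteness) h4).2 ?_
    rw [add_comm]
    exact (ENNReal.sub_lt_iff_lt_right hεt hε1).1 h3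

/-- Predictive distributions of `P` that dominate the reweighted predictive distributions of `Q`
merge with them almost surely off the singular part of `P`. -/
theorem ae_mem_merges [IsFiniteMeasure P] [IsFiniteMeasure Q]
    (hp : IsLocalDensity P M p) (hq : IsLocalDensity Q M q) {r : SeqSpace X → ℝ≥0}
    {N : Set (SeqSpace X)} (h : IsLebesgueSplitting P Q r N)
    {κP κQ : ∀ ℓ, Kernel (Past X ℓ) (Future X ℓ)} (hκP : IsPredictive P κP)
    (hκQ : IsPredictive Q κQ)
    (hle : ∀ ℓ, ∀ᵐ x ∂(P.map (past ℓ)),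
      (κQ ℓ x).withDensity (fun y => q ℓ x / p ℓ x * r ((split X ℓ).symm (x, y))) ≤ κP ℓ x) :
    ∀ᵐ ω ∂P, ω ∉ N → ω ∈ merges κP κQ := by
  have hmP : ∀ ℓ, IsMarkovKernel (κP ℓ) := fun ℓ => (hκP ℓ).1
  have hmQ : ∀ ℓ, IsMarkovKernel (κQ ℓ) := fun ℓ => (hκQ ℓ).1
  have hlimQ : ∀ᵐ ω ∂Q, ∀ c : ℚ, Tendsto (fun ℓ => ∫⁻ y, (1 - (Real.toNNReal c : ℝ≥0∞)
      * r ((split X ℓ).symm (past ℓ ω, y))) ∂(κQ ℓ (past ℓ ω))) atTop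
      (𝓝 (1 - (Real.toNNReal c : ℝ≥0∞) * r ω)) := by
    refine ae_all_iff.2 fun c => tendsto_lintegral_predictive hκQ
      (φ := fun ω => 1 - (Real.toNNReal c : ℝ≥0∞) * r ω)
      (measurable_const.sub (h.measurable_coe.const_mul _)) ?_
    refine ne_top_of_le_ne_top (measure_ne_top Q Set.univ) ?_
    calc _ ≤ ∫⁻ _, 1 ∂Q := lintegral_mono fun ω => tsub_le_self
      _ = Q Set.univ := by simp
  have hle' : ∀ᵐ ω ∂P, ∀ ℓ, (κQ ℓ (past ℓ ω)).withDensity (fun y =>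
      q ℓ (past ℓ ω) / p ℓ (past ℓ ω) * r ((split X ℓ).symm (past ℓ ω, y))) ≤ κP ℓ (past ℓ ω) :=
    ae_all_iff.2 fun ℓ => ae_of_ae_map (measurable_past ℓ).aemeasurable (hle ℓ)
  -- Off `N`, `P` has `Q`-density `r`, so `Q`-a.e. limits hold `P`-a.e. there, and `r ω ≠ 0`.
  filter_upwards [tendsto_ratio hp hq h, hle', h.ae_of_ae hlimQ] with ω hrat hdom hlim hN
  obtain ⟨hr0, hlim⟩ := hlim hN
  rw [Set.indicator_of_mem (show ω ∈ Nᶜ from hN)] at hrat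
  have hzero : Tendsto (fun ℓ => ∫⁻ y, (1 - q ℓ (past ℓ ω) / p ℓ (past ℓ ω)
      * r ((split X ℓ).symm (past ℓ ω, y))) ∂(κQ ℓ (past ℓ ω))) atTop (𝓝 0) := by
    -- Freeze the ratio at a constant `c` just below its limit `1 / r ω`; a larger ratio only
    -- shrinks the integrand.
    refine ENNReal.tendsto_nhds_zero.2 fun ε hε => ?_
    obtain ⟨c, hc1, hc2⟩ := exists_rat_one_sub_mul_lt (a := (r ω : ℝ≥0∞)) (by simpa using hr0)
      ENNReal.coe_ne_top hε
    filter_upwards [Tendsto.eventually_const_lt hc1 hrat, Tendsto.eventually_lt_const hc2 (hlim c)]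
      with ℓ h1 h2
    refine le_trans (lintegral_mono fun y => ?_) h2.le
    exact tsub_le_tsub_left (mul_le_mul_left h1.le _) _
  refine squeeze_zero (fun ℓ => tvd_nonneg _ _ _) (fun ℓ => tvd_le (κP ℓ) (κQ ℓ) _ ?_ (hdom ℓ))
    ((ENNReal.tendsto_toReal ENNReal.zero_ne_top).comp hzero)
  exact (h.measurable_coe.comp
    ((split X ℓ).symm.measurable.comp measurable_prodMk_left)).const_mul _

/-- Over countably generated symbol spaces, predictive distributions are almost surely unique. -/
lemma IsPredictive.ae_eq [∀ t, MeasurableSpace.CountablyGenerated (X t)] [IsFiniteMeasure P]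
    {κ κ' : ∀ ℓ, Kernel (Past X ℓ) (Future X ℓ)} (hκ : IsPredictive P κ)
    (hκ' : IsPredictive P κ') : ∀ᵐ ω ∂P, ∀ ℓ, κ ℓ (past ℓ ω) = κ' ℓ (past ℓ ω) := by
  refine ae_all_iff.2 fun ℓ => ae_of_ae_map (measurable_past ℓ).aemeasurable
    (p := fun x => κ ℓ x = κ' ℓ x) ?_
  have := (hκ ℓ).1
  have := (hκ' ℓ).1
  have : MeasurableSpace.CountablyGenerated (Future X ℓ) := countablyGenerated_pi
  exact Kernel.ae_eq_of_compProd_eq ((hκ.compProd_eq ℓ).trans (hκ'.compProd_eq ℓ).symm)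

lemma merges_congr {κ κ' κQ : ∀ ℓ, Kernel (Past X ℓ) (Future X ℓ)} {ω : SeqSpace X}
    (h : ∀ ℓ, κ ℓ (past ℓ ω) = κ' ℓ (past ℓ ω)) : ω ∈ merges κ κQ ↔ ω ∈ merges κ' κQ := by
  simp only [merges, Set.mem_ofPred_eq, tvd, condProb, h]

/-- The given version `κ` only serves to disintegrate the singular part of `P`, by restriction to
`N`; the rest comes from `κQ`. -/
theorem exists_predictive_ae_ratioVanishes_or_merges [IsFiniteMeasure P] [IsFiniteMeasure Q]
    (hp : IsLocalDensity P M p) (hq : IsLocalDensity Q M q)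
    {κ κQ : ∀ ℓ, Kernel (Past X ℓ) (Future X ℓ)} (hκ : IsPredictive P κ)
    (hκQ : IsPredictive Q κQ) :
    ∃ κP : ∀ ℓ, Kernel (Past X ℓ) (Future X ℓ), IsPredictive P κP ∧
      ∀ᵐ ω ∂P, ω ∈ ratioVanishes p q ∪ merges κP κQ := by
  obtain ⟨r, N, h⟩ := exists_isLebesgueSplitting P Q
  have hm : ∀ ℓ, IsMarkovKernel (κ ℓ) := fun ℓ => (hκ ℓ).1
  obtain ⟨κP, hκP, hle⟩ := exists_predictive_ge hp hq h hκQ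
    (fun ℓ => (κ ℓ).withDensity
      (fun x y => ((N.indicator 1 ((split X ℓ).symm (x, y)) : ℝ≥0) : ℝ≥0∞)))
    (fun ℓ => compProd_withDensity_indicator hκ h.measurableSet ℓ)
  refine ⟨κP, hκP, ?_⟩
  filter_upwards [ae_mem_ratioVanishes_iff hp hq h, ae_mem_merges hp hq h hκP hκQ hle]
    with ω h1 h2
  by_cases hN : ω ∈ N
  · exact Or.inl (h1.2 hN)
  · exact Or.inr (h2 hN)

theorem exists_predictive_ae_merges [IsFiniteMeasure P] [IsFiniteMeasure Q]
    (hp : IsLocalDensity P M p) (hq : IsLocalDensity Q M q) (hPQ : P ≪ Q)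
    {κQ : ∀ ℓ, Kernel (Past X ℓ) (Future X ℓ)} (hκQ : IsPredictive Q κQ) :
    ∃ κP : ∀ ℓ, Kernel (Past X ℓ) (Future X ℓ), IsPredictive P κP ∧
      ∀ᵐ ω ∂P, ω ∈ merges κP κQ := by
  have h := isLebesgueSplitting_of_absolutelyContinuous hPQ
  obtain ⟨κP, hκP, hle⟩ := exists_predictive_ge hp hq h hκQ (fun ℓ => 0) (fun ℓ => by simp)
  refine ⟨κP, hκP, ?_⟩
  filter_upwards [ae_mem_merges hp hq h hκP hκQ hle] with ω h1 using h1 (Set.notMem_empty ω)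

theorem ae_ratioVanishes_or_merges [∀ t, MeasurableSpace.CountablyGenerated (X t)]
    [IsFiniteMeasure P] [IsFiniteMeasure Q]
    (hp : IsLocalDensity P M p) (hq : IsLocalDensity Q M q)
    {κP κQ : ∀ ℓ, Kernel (Past X ℓ) (Future X ℓ)} (hκP : IsPredictive P κP)
    (hκQ : IsPredictive Q κQ) :
    ∀ᵐ ω ∂P, ω ∈ ratioVanishes p q ∪ merges κP κQ := by
  obtain ⟨κ, hκ, hmerge⟩ := exists_predictive_ae_ratioVanishes_or_merges hp hq hκP hκQ
  filter_upwards [hmerge, hκP.ae_eq hκ] with ω h1 h2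
  exact h1.imp id (merges_congr h2).2

end Merging

end MergingOfOpinions

theorem lemma2 {X : ℕ → Type*} [∀ t, MeasurableSpace (X t)]
    (P Q : Measure (SeqSpace X)) [IsProbabilityMeasure P] [IsProbabilityMeasure Q]
    (M : ∀ ℓ, Measure (Past X ℓ)) (p q : ∀ ℓ, Past X ℓ → ℝ≥0∞)
    (hp : IsLocalDensity P M p) (hq : IsLocalDensity Q M q) :
    -- (i)
    (P ≪ Q ↔ P (ratioVanishes p q) = 0) ∧
    -- (ii) and (iii) for all versions of the predictive distributions, over countably generated
    -- symbol spaces (where these versions are almost surely unique)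
    ((∀ t, MeasurableSpace.CountablyGenerated (X t)) →
      ∀ κP κQ : ∀ ℓ, Kernel (Past X ℓ) (Future X ℓ), IsPredictive P κP → IsPredictive Q κQ →
        (P (ratioVanishes p q) = 0 → ∀ᵐ ω ∂P, ω ∈ merges κP κQ) ∧
        (∀ᵐ ω ∂P, ω ∈ ratioVanishes p q ∪ merges κP κQ)) ∧
    -- (ii) and (iii) over arbitrary symbol spaces: for every version of the predictive
    -- distributions of `Q`, with a suitable version of those of `P`
    (∀ κQ : ∀ ℓ, Kernel (Past X ℓ) (Future X ℓ), IsPredictive Q κQ →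
      (P (ratioVanishes p q) = 0 →
        ∃ κP : ∀ ℓ, Kernel (Past X ℓ) (Future X ℓ), IsPredictive P κP ∧
          ∀ᵐ ω ∂P, ω ∈ merges κP κQ) ∧
      ((∃ κ : ∀ ℓ, Kernel (Past X ℓ) (Future X ℓ), IsPredictive P κ) →
        ∃ κP : ∀ ℓ, Kernel (Past X ℓ) (Future X ℓ), IsPredictive P κP ∧
          ∀ᵐ ω ∂P, ω ∈ ratioVanishes p q ∪ merges κP κQ)) := by
  refine ⟨absolutelyContinuous_iff_ratioVanishes hp hq, fun hX κP κQ hκP hκQ => ?_,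
    fun κQ hκQ => ⟨fun h0 => ?_, fun ⟨κ, hκ⟩ => ?_⟩⟩
  · have h := ae_ratioVanishes_or_merges hp hq hκP hκQ
    refine ⟨fun h0 => ?_, h⟩
    filter_upwards [h, measure_eq_zero_iff_ae_notMem.1 h0] with ω h1 h2 using h1.resolve_left h2
  · exact exists_predictive_ae_merges hp hq
      ((absolutelyContinuous_iff_ratioVanishes hp hq).2 h0) hκQ
  · exact exists_predictive_ae_ratioVanishes_or_merges hp hq hκ hκQ
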